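/- Let $\mathcal{S}$ be a finite non-empty state space and let $\epsilon>0$. Let $\mathcal{M}$ be the class of all irreducible Markov chains on $\mathcal{S}$. For $p\in\mathcal{M}$ with transition matrix $P$ and (unique) stationary distribution $\pi_p$, let the process $X_0,X_1,X_2,\dots$ be generated by drawing $X_0$ from $\pi_p$ and then moving according to $P$; write $X_1^n=(X_1,\dots,X_n)$ and denote the law of the process also by $p$. A prediction rule $\Phi$ assigns to every finite string over $\mathcal{S}$ a probability vector in $\mathbb{R}^{\mathcal{S}}$ (nonnegative entries with sum $1$), and a stopping rule $\tau$ assigns to every finite string a value in $\{0,1\}$. The loss of a prediction $y$ is $\ell(p,X_1^k,y)=1$ if $\max_{s\in\mathcal{S}}|y(s)-\pi_p(s)|>\epsilon$, and $\ell(p,X_1^k,y)=0$ otherwise. Then $(\mathcal{M},\ell)$ is eventually almost surely (e.a.s.) learnable: for every $\eta>0$ there are a prediction rule $\Phi_\eta$ and a stopping rule $\tau_\eta$ (which do not depend on $p$) such that for all $p\in\mathcal{M}$ $$p\Bigl(\sum_{k=\min\{n\ge 1\,:\,\tau_\eta(X_1^n)=1\}}^{\infty}\ell\bigl(p,X_1^k,\Phi_\eta(X_1^{k-1})\bigr)>0\Bigr)<\eta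 \qquad\text{and}\qquad p\bigl(\exists\, n\ge 1:\ \tau_\eta(X_1^n)=1\bigr)=1,$$ where the sum is empty if $\tau_\eta$ never takes the value $1$ along the process. -/

import Mathlib

open MeasureTheory ProbabilityTheory
open scoped ENNReal Matrix

/-- A sample path is `ω : ℕ → X`, with `ω n` the value of `X_n`. The observation available after
`n` steps is the string `X_1, …, X_n` (the value `X_0` is not shown to the learner). -/
def observed {X : Type*} (ω : ℕ → X) (n : ℕ) : Fin n → X := fun i => ω (i + 1)

/-- The time `min {n ≥ 1 | τ (X_1, …, X_n) = 1}`, with value `∞` if there is no such `n`. -/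
noncomputable def stopTime {X : Type*} (τ : (n : ℕ) → (Fin n → X) → Fin 2) (ω : ℕ → X) : ℕ∞ :=
  ⨅ (n : ℕ) (_ : 1 ≤ n ∧ τ n (observed ω n) = 1), (n : ℕ∞)

/-- Eventually almost sure learnability of a class `M` of models. The model `p : M` generates
`X_0, X_1, X_2, …` with law `law p`, and `loss p k x y ∈ {0, 1}` is the loss at time `k` of the
prediction `y` when `X_1, …, X_k` is `x`. The prediction used at time `k` is
`Φ (X_1, …, X_{k-1})`. Rules may depend on the confidence `η`, but not on the model. Stopping
times are at least `1`, so the sum only involves times `k ≥ 1`. -/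
def EASLearnable {M X Y : Type*} [MeasurableSpace X] [MeasurableSpace Y]
    (law : M → Measure (ℕ → X)) (loss : M → (k : ℕ) → (Fin k → X) → Y → Fin 2) : Prop :=
  ∀ η : ℝ, 0 < η →
    ∃ (Φ : (n : ℕ) → (Fin n → X) → Y) (τ : (n : ℕ) → (Fin n → X) → Fin 2),
      (∀ n, Measurable (Φ n)) ∧ (∀ n, Measurable (τ n)) ∧
      ∀ p : M,
        law p {ω | 0 < ∑' k : {k : ℕ // stopTime τ ω ≤ k},
            ((loss p k (observed ω k) (Φ (k - 1) (observed ω (k - 1))) : ℕ) : ℝ≥0∞)}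
          < ENNReal.ofReal η ∧
        law p {ω | ∃ n : ℕ, 1 ≤ n ∧ τ n (observed ω n) = 1} = 1

/-- An irreducible Markov chain on the finite state space `S`, given by its transition matrix:
`P s t` is the probability of moving from `s` to `t`. -/
structure IrreducibleChain (S : Type*) [Fintype S] [DecidableEq S] where
  /-- The transition matrix. -/
  P : Matrix S S ℝ
  stochastic : P ∈ Matrix.rowStochastic ℝ S
  irreducible : P.IsIrreducible

namespace IrreducibleChain

section Stationary

variable {S : Type*} [Fintype S] [DecidableEq S] (p : IrreducibleChain S)

lemma abs_fixed {v : S → ℝ} (hv : v ᵥ* p.P = v) :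
    (fun s => |v s|) ᵥ* p.P = fun s => |v s| := by
  have hle : ∀ t ∈ Finset.univ, |v t| ≤ ((fun s => |v s|) ᵥ* p.P) t := by
    intro t _
    have h : v t = ∑ s, v s * p.P s t := by
      conv_lhs => rw [← hv]
      rfl
    rw [h]
    refine (Finset.abs_sum_le_sum_abs _ _).trans (le_of_eq ?_)
    refine Finset.sum_congr rfl fun s _ => ?_
    rw [abs_mul, abs_of_nonneg (p.stochastic.1 s t)]
  have hsum : ∑ t, |v t| = ∑ t, ((fun s => |v s|) ᵥ* p.P) t := by
    simp only [Matrix.vecMul, dotProduct]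
    rw [Finset.sum_comm]
    refine Finset.sum_congr rfl fun s _ => ?_
    rw [← Finset.mul_sum, Matrix.sum_row_of_mem_rowStochastic p.stochastic, mul_one]
  funext t
  exact ((Finset.sum_eq_sum_iff_of_le hle).1 hsum t (Finset.mem_univ t)).symm

lemma pos_of_fixed {v : S → ℝ} (h0 : ∀ s, 0 ≤ v s) (hv : v ᵥ* p.P = v) {i : S} (hi : 0 < v i)
    (j : S) : 0 < v j := by
  obtain ⟨k, -, hk⟩ :=
    (Matrix.isIrreducible_iff_exists_pow_pos p.irreducible.nonneg).1 p.irreducible i j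
  have hpow : ∀ m : ℕ, v ᵥ* (p.P ^ m) = v := by
    intro m
    induction m with
    | zero => simp
    | succ m ih => rw [pow_succ, ← Matrix.vecMul_vecMul, ih, hv]
  have hkm : p.P ^ k ∈ Matrix.rowStochastic ℝ S := pow_mem p.stochastic k
  rw [← hpow k]
  refine Finset.sum_pos' (fun s _ => mul_nonneg (h0 s) (hkm.1 s j)) ⟨i, Finset.mem_univ i, ?_⟩
  exact mul_pos hi hk

lemma eq_zero_of_fixed {v : S → ℝ} (hv : v ᵥ* p.P = v) (hs : ∑ s, v s = 0) : v = 0 := by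
  have ha := p.abs_fixed hv
  have h1 : (fun s => |v s| + v s) ᵥ* p.P = fun s => |v s| + v s := by
    have := Matrix.add_vecMul p.P (fun s => |v s|) v
    rw [ha, hv] at this
    exact this
  by_contra hne
  have hpos : ∃ i ∈ Finset.univ, 0 < v i := by
    apply Finset.exists_pos_of_sum_zero_of_exists_nonzero _ hs
    by_contra! h
    exact hne (funext fun i => h i (Finset.mem_univ i))
  obtain ⟨i, -, hi⟩ := hpos
  have hall : ∀ j, 0 < v j := by
    intro j
    have := p.pos_of_fixed (v := fun s => |v s| + v s)
      (fun s => by linarith [neg_abs_le (v s)]) h1 (i := i) (by positivity) j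
    by_contra! hj
    simp only [abs_of_nonpos hj] at this
    linarith
  have : 0 < ∑ s, v s := Finset.sum_pos (fun s _ => hall s) ⟨i, Finset.mem_univ i⟩
  linarith

/-- An irreducible chain on a finite non-empty state space has exactly one stationary
distribution. -/
theorem existsUnique_stationary [Nonempty S] :
    ∃! π : stdSimplex ℝ S, (π : S → ℝ) ᵥ* p.P = π := by
  have hdet : (1 - p.P).det = 0 := by
    rw [← Matrix.exists_mulVec_eq_zero_iff]
    refine ⟨1, one_ne_zero, ?_⟩
    rw [Matrix.sub_mulVec, Matrix.one_mulVec, p.stochastic.2, sub_self]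
  obtain ⟨v, hv0, hv⟩ := Matrix.exists_vecMul_eq_zero_iff.2 hdet
  rw [Matrix.vecMul_sub, Matrix.vecMul_one, sub_eq_zero] at hv
  have ha := p.abs_fixed hv.symm
  have hsum : 0 < ∑ s, |v s| := by
    obtain ⟨i, hi⟩ := Function.ne_iff.1 hv0
    exact Finset.sum_pos' (fun s _ => abs_nonneg _) ⟨i, Finset.mem_univ i, abs_pos.2 hi⟩
  refine ⟨⟨(∑ s, |v s|)⁻¹ • fun s => |v s|, fun s => ?_, ?_⟩, ?_, ?_⟩
  · exact mul_nonneg (inv_nonneg.2 hsum.le) (abs_nonneg _)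
  · simp only [Pi.smul_apply, smul_eq_mul, ← Finset.mul_sum]
    exact inv_mul_cancel₀ hsum.ne'
  · change ((∑ s, |v s|)⁻¹ • fun s => |v s|) ᵥ* p.P = (∑ s, |v s|)⁻¹ • fun s => |v s|
    rw [Matrix.smul_vecMul, ha]
  · intro π hπ
    have hσ : ((∑ s, |v s|)⁻¹ • fun s => |v s|) ᵥ* p.P = (∑ s, |v s|)⁻¹ • fun s => |v s| := by
      rw [Matrix.smul_vecMul, ha]
    have := p.eq_zero_of_fixed (v := (π : S → ℝ) - (∑ s, |v s|)⁻¹ • fun s => |v s|)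
      (by rw [Matrix.sub_vecMul, hπ, hσ]) (by
        simp only [Pi.sub_apply, Pi.smul_apply, smul_eq_mul, Finset.sum_sub_distrib,
          ← Finset.mul_sum]
        rw [inv_mul_cancel₀ hsum.ne', sub_eq_zero]
        exact π.2.2)
    exact Subtype.ext (sub_eq_zero.1 this)

/-- The stationary distribution `π` of the chain, i.e. the unique probability vector with
`π P = π`. -/
noncomputable def stationary [Nonempty S] : stdSimplex ℝ S :=
  p.existsUnique_stationary.choose

/-- The `s`-th row of the transition matrix, as a probability vector. -/
def row (s : S) : stdSimplex ℝ S :=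
  ⟨p.P s, p.stochastic.1 s, Matrix.sum_row_of_mem_rowStochastic p.stochastic s⟩

end Stationary

end IrreducibleChain

/-- The probability measure on a finite set with the given probability vector. -/
noncomputable def vecMeasure {S : Type*} [Fintype S] [MeasurableSpace S]
    (v : stdSimplex ℝ S) : Measure S :=
  ∑ s, ENNReal.ofReal ((v : S → ℝ) s) • Measure.dirac s

instance {S : Type*} [Fintype S] [MeasurableSpace S] (v : stdSimplex ℝ S) :
    IsProbabilityMeasure (vecMeasure v) where
  measure_univ := by
    simp only [vecMeasure, Measure.finsetSum_apply, Measure.smul_apply, measure_univ,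
      smul_eq_mul, mul_one]
    refine (ENNReal.ofReal_sum_of_nonneg fun s _ => v.2.1 s).symm.trans ?_
    exact (congrArg ENNReal.ofReal v.2.2).trans ENNReal.ofReal_one

namespace IrreducibleChain

section Law

variable {S : Type*} [Fintype S] [DecidableEq S] [MeasurableSpace S] [DiscreteMeasurableSpace S]
  (p : IrreducibleChain S)

/-- Given the history `X_0, …, X_n`, the next state `X_{n+1}` is drawn from the row of `X_n`. -/
noncomputable def stepKernel (n : ℕ) : Kernel (Finset.Iic n → S) S where
  toFun h := vecMeasure (p.row (h ⟨n, Finset.mem_Iic.2 le_rfl⟩))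
  measurable' := Measurable.of_discrete

instance (n : ℕ) : IsMarkovKernel (p.stepKernel n) :=
  ⟨fun _ => inferInstanceAs (IsProbabilityMeasure (vecMeasure _))⟩

/-- The law of the stationary process `X_0, X_1, X_2, …`: the initial state `X_0` is drawn from
the stationary distribution, and the transitions are those of `p`. -/
noncomputable def stationaryLaw [Nonempty S] : Measure (ℕ → S) :=
  Kernel.trajMeasure (X := fun _ => S) (vecMeasure p.stationary) p.stepKernel

end Law

/-- The loss at time `k` of the probability vector `y`: it is `1` if the sup-norm distance of `y`
to the stationary distribution exceeds `ε`, and `0` otherwise. -/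
noncomputable def stationaryLoss {S : Type*} [Fintype S] [DecidableEq S] [Nonempty S] (ε : ℝ)
    (p : IrreducibleChain S) (k : ℕ) (_x : Fin k → S) (y : stdSimplex ℝ S) : Fin 2 :=
  if ε < ‖(y : S → ℝ) - (p.stationary : S → ℝ)‖ then 1 else 0

end IrreducibleChain

/-! Mixing can be arbitrarily slow over the class, so no fixed sample size works for every chain;
the learner instead keeps the set of chains not yet refuted. Under the true chain, transition counts
minus their predicted values form a martingale with increments bounded by 1. At time `N ^ 4` they
exceed `N ^ 3` with probability at most `1 / N ^ 2`, whatever the chain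
(`measure_fluctuation_gt_le`). Testing at sparse times makes the total error less than `η`, so with
probability above `1 - η` the true chain is never refuted, and a prediction `ε`-close to the
stationary vectors of all surviving chains has no loss. Such a prediction eventually exists because
of `exists_norm_stationary_sub_le`. For a fixed true chain `p` and large `N`, passing the test puts
the occupation vector near the positive vector `p.stationary`. Every state is then visited often, so
any other surviving chain has almost the same transition matrix, hence almost the same stationary
vector. -/

/-- The fluctuation of the number of transitions from `s` to `t` among the first `n` transitions
of `X_1, X_2, …`, around the value predicted by the transition matrix `Q`. -/
noncomputable def fluctuation {S : Type*} [DecidableEq S] (Q : Matrix S S ℝ) (s t : S) (n : ℕ)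
    (ω : ℕ → S) : ℝ :=
  ∑ i ∈ Finset.range n,
    if ω (i + 1) = s then (if ω (i + 2) = t then 1 else 0) - Q s t else 0

lemma fluctuation_congr {S : Type*} [DecidableEq S] (Q : Matrix S S ℝ) (s t : S) {n : ℕ}
    {ω ω' : ℕ → S} (h : ∀ i, 1 ≤ i → i ≤ n + 1 → ω i = ω' i) :
    fluctuation Q s t n ω = fluctuation Q s t n ω' := by
  refine Finset.sum_congr rfl fun i hi => ?_
  rw [Finset.mem_range] at hi
  rw [h (i + 1) (by omega) (by omega), h (i + 2) (by omega) (by omega)]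

lemma measurable_fluctuation {S : Type*} [DecidableEq S] [MeasurableSpace S]
    [DiscreteMeasurableSpace S] (Q : Matrix S S ℝ) (s t : S) (n : ℕ) :
    Measurable (fluctuation Q s t n) := by
  have hev : ∀ (k : ℕ) (u : S), MeasurableSet {ω : ℕ → S | ω k = u} := fun k u =>
    measurable_pi_apply (X := fun _ : ℕ => S) k (MeasurableSet.of_discrete (s := {u}))
  exact Finset.measurable_sum _ fun i _ => Measurable.ite (hev _ _)
    ((Measurable.ite (hev _ _) measurable_const measurable_const).sub measurable_const)
    measurable_const

lemma abs_fluctuation_le {S : Type*} [Fintype S] [DecidableEq S] {Q : Matrix S S ℝ}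
    (hQ : Q ∈ Matrix.rowStochastic ℝ S) (s t : S) (n : ℕ) (ω : ℕ → S) :
    |fluctuation Q s t n ω| ≤ n := by
  have h0 : 0 ≤ Q s t := hQ.1 s t
  have h1 : Q s t ≤ 1 := Matrix.le_one_of_mem_rowStochastic hQ
  refine (Finset.abs_sum_le_sum_abs _ _).trans ?_
  refine (Finset.sum_le_card_nsmul _ _ 1 fun i _ => ?_).trans (by simp)
  split_ifs <;> rw [abs_le] <;> constructor <;> linarith

lemma integral_vecMeasure {S : Type*} [Fintype S] [MeasurableSpace S] [DiscreteMeasurableSpace S]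
    (v : stdSimplex ℝ S) (f : S → ℝ) :
    ∫ x, f x ∂(vecMeasure v) = ∑ s, (v : S → ℝ) s * f s := by
  rw [vecMeasure, integral_finsetSum_measure
    fun s _ => (Integrable.of_finite).smul_measure ENNReal.ofReal_ne_top]
  refine Finset.sum_congr rfl fun s _ => ?_
  rw [integral_smul_measure, integral_dirac]
  exact congrArg (· * f s) (ENNReal.toReal_ofReal (v.2.1 s))

/-! ### Martingale moment bounds for the transition counts -/

namespace IrreducibleChain

section Probability

variable {S : Type*} [Fintype S] [Nonempty S] [DecidableEq S] [MeasurableSpace S]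
  [DiscreteMeasurableSpace S] (p : IrreducibleChain S)

instance : IsProbabilityMeasure p.stationaryLaw :=
  inferInstanceAs (IsProbabilityMeasure (Kernel.trajMeasure _ _))

lemma integral_past_and_next (a : ℕ) (g : (Finset.Iic a → S) → S → ℝ) :
    ∫ ω, g (Preorder.frestrictLe a ω) (ω (a + 1)) ∂p.stationaryLaw =
      ∫ ω, ∑ u, p.P (ω a) u * g (Preorder.frestrictLe a ω) u ∂p.stationaryLaw := by
  have hm := Kernel.map_frestrictLe_trajMeasure_compProd_eq_map_trajMeasure
    (X := fun _ => S) (μ₀ := vecMeasure p.stationary) (κ := p.stepKernel) (a := a)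
  have hg : StronglyMeasurable (fun z : (Finset.Iic a → S) × S => g z.1 z.2) :=
    .of_discrete
  have h1 : ∫ ω, g (Preorder.frestrictLe a ω) (ω (a + 1)) ∂p.stationaryLaw =
      ∫ z : (Finset.Iic a → S) × S, g z.1 z.2
        ∂(p.stationaryLaw.map fun ω => (Preorder.frestrictLe a ω, ω (a + 1))) := by
    rw [integral_map (by fun_prop) hg.aestronglyMeasurable]
  rw [h1]
  change ∫ z : (Finset.Iic a → S) × S, g z.1 z.2 ∂((Kernel.trajMeasure (X := fun _ => S) _ _).map _) = _
  have : IsProbabilityMeasure ((Kernel.trajMeasure (X := fun _ => S) (vecMeasure p.stationary)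
      p.stepKernel).map (Preorder.frestrictLe a)) :=
    Measure.isProbabilityMeasure_map (by fun_prop)
  rw [← hm, Measure.integral_compProd .of_finite,
    integral_map (by fun_prop) StronglyMeasurable.of_discrete.aestronglyMeasurable]
  refine integral_congr_ae (.of_forall fun ω => ?_)
  exact integral_vecMeasure (p.row (ω a)) _

/-- The martingale property: given the past, the increment averages to zero over the row of `s`. -/
lemma integral_past_mul_increment (s t : S) (a : ℕ) {F : (ℕ → S) → ℝ}
    (hF : ∀ ω ω' : ℕ → S, (∀ i ≤ a, ω i = ω' i) → F ω = F ω') :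
    ∫ ω, F ω * (if ω a = s then (if ω (a + 1) = t then 1 else 0) - p.P s t else 0)
      ∂p.stationaryLaw = 0 := by
  -- Padding a finite history to a full path lets `F` be viewed as a function of the history alone.
  let ext : (Finset.Iic a → S) → ℕ → S := fun h i =>
    if hi : i ≤ a then h ⟨i, Finset.mem_Iic.2 hi⟩ else Classical.arbitrary S
  have hext : ∀ ω : ℕ → S, F ω = F (ext (Preorder.frestrictLe a ω)) := fun ω =>
    hF _ _ fun i hi => by simp [ext, hi]
  have key := p.integral_past_and_next a fun h u => F (ext h) *
    (if h ⟨a, Finset.mem_Iic.2 le_rfl⟩ = s then (if u = t then 1 else 0) - p.P s t else 0)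
  simp only [← hext, Preorder.frestrictLe_apply] at key
  refine key.trans ((integral_congr_ae (.of_forall fun ω => ?_)).trans (integral_zero _ _))
  by_cases hs : ω a = s
  · have hrow := Matrix.sum_row_of_mem_rowStochastic p.stochastic s
    have : ∑ u, p.P s u * ((if u = t then 1 else 0) - p.P s t) = 0 := by
      simp [mul_sub, Finset.sum_sub_distrib, ← Finset.sum_mul, hrow]
    simp only [hs, if_true]
    refine Eq.trans ?_ ((congrArg (F ω * ·) this).trans (mul_zero _))
    simp only [Finset.mul_sum]
    exact Finset.sum_congr rfl fun u _ => by ring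
  · simp [hs]

lemma integrable_fluctuation_pow (s t : S) (n k : ℕ) :
    Integrable (fun ω => fluctuation p.P s t n ω ^ k) p.stationaryLaw := by
  refine .of_bound ((measurable_fluctuation _ s t n).pow_const k).aestronglyMeasurable
    ((n : ℝ) ^ k) (.of_forall fun ω => ?_)
  rw [norm_pow]
  exact pow_le_pow_left₀ (norm_nonneg _) (abs_fluctuation_le p.stochastic s t n ω) k

/-- Martingale increments are orthogonal, and each contributes at most 1 to the second moment. -/
lemma integral_fluctuation_sq_le (s t : S) (n : ℕ) :
    ∫ ω, fluctuation p.P s t n ω ^ 2 ∂p.stationaryLaw ≤ n := by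
  induction n with
  | zero => simp [fluctuation]
  | succ n ih =>
    set Z : (ℕ → S) → ℝ := fun ω =>
      if ω (n + 1) = s then (if ω (n + 2) = t then 1 else 0) - p.P s t else 0 with hZ
    have hsucc : ∀ ω, fluctuation p.P s t (n + 1) ω = fluctuation p.P s t n ω + Z ω :=
      fun ω => Finset.sum_range_succ _ _
    have hZm : Measurable Z := by
      have : Z = fun ω => fluctuation p.P s t (n + 1) ω - fluctuation p.P s t n ω := by
        funext ω; rw [hsucc]; ring
      rw [this]
      exact (measurable_fluctuation _ _ _ _).sub (measurable_fluctuation _ _ _ _)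
    have hZ1 : ∀ ω, |Z ω| ≤ 1 := fun ω => by
      have h0 : 0 ≤ p.P s t := p.stochastic.1 s t
      have h1 : p.P s t ≤ 1 := Matrix.le_one_of_mem_rowStochastic p.stochastic
      simp only [hZ]
      split_ifs <;> rw [abs_le] <;> constructor <;> linarith
    have hint : Integrable (fun ω => fluctuation p.P s t n ω * Z ω) p.stationaryLaw := by
      have := (p.integrable_fluctuation_pow s t n 1).mul_bdd (c := 1)
        hZm.aestronglyMeasurable (.of_forall hZ1)
      simpa using this
    have hcross : ∫ ω, fluctuation p.P s t n ω * Z ω ∂p.stationaryLaw = 0 :=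
      p.integral_past_mul_increment s t (n + 1) fun ω ω' h =>
        fluctuation_congr _ _ _ fun i _ hi => h i hi
    calc ∫ ω, fluctuation p.P s t (n + 1) ω ^ 2 ∂p.stationaryLaw
        ≤ ∫ ω, (fluctuation p.P s t n ω ^ 2 + 2 * (fluctuation p.P s t n ω * Z ω)) + 1
            ∂p.stationaryLaw := by
          refine integral_mono (p.integrable_fluctuation_pow s t _ 2)
            (((p.integrable_fluctuation_pow s t n 2).add (hint.const_mul 2)).add
              (integrable_const 1)) fun ω => ?_
          have := (sq_le_one_iff_abs_le_one _).2 (hZ1 ω)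
          simp only [hsucc]
          linarith
      _ = ∫ ω, fluctuation p.P s t n ω ^ 2 ∂p.stationaryLaw + 1 := by
          have hadd : Integrable (fun ω => fluctuation p.P s t n ω ^ 2 +
              2 * (fluctuation p.P s t n ω * Z ω)) p.stationaryLaw :=
            (p.integrable_fluctuation_pow s t n 2).add (hint.const_mul 2)
          rw [integral_add hadd (integrable_const 1), integral_add (p.integrable_fluctuation_pow s t n 2)
            (hint.const_mul 2), integral_const_mul, hcross]
          simp
      _ ≤ (n + 1 : ℕ) := by push_cast; linarith

lemma measure_fluctuation_gt_le (s t : S) {N : ℕ} (hN : 0 < N) :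
    p.stationaryLaw {ω | (N : ℝ) ^ 3 < |fluctuation p.P s t (N ^ 4) ω|} ≤
      ENNReal.ofReal (1 / (N : ℝ) ^ 2) := by
  have hN' : (0 : ℝ) < N := Nat.cast_pos.2 hN
  have h := mul_meas_ge_le_integral_of_nonneg (μ := p.stationaryLaw)
    (.of_forall fun ω => sq_nonneg (fluctuation p.P s t (N ^ 4) ω))
    (p.integrable_fluctuation_pow s t (N ^ 4) 2) ((N : ℝ) ^ 6)
  have h2 := h.trans (p.integral_fluctuation_sq_le s t (N ^ 4))
  have hsub : {ω | (N : ℝ) ^ 3 < |fluctuation p.P s t (N ^ 4) ω|} ⊆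
      {ω | (N : ℝ) ^ 6 ≤ fluctuation p.P s t (N ^ 4) ω ^ 2} := fun ω hω => by
    have := pow_le_pow_left₀ (by positivity) (Set.mem_ofPred.1 hω).le 2
    rw [sq_abs, ← pow_mul] at this
    exact this
  refine (measure_mono hsub).trans ?_
  rw [← ofReal_measureReal]
  refine ENNReal.ofReal_le_ofReal ?_
  rw [le_div_iff₀ (by positivity)]
  push_cast at h2
  have h4 : (0 : ℝ) < (N : ℝ) ^ 4 := by positivity
  refine le_of_mul_le_mul_left ?_ h4
  calc _ = (N : ℝ) ^ 6 * p.stationaryLaw.real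
        {ω | (N : ℝ) ^ 6 ≤ fluctuation p.P s t (N ^ 4) ω ^ 2} := by ring
    _ ≤ _ := by rw [mul_one]; exact h2

lemma measure_exists_fluctuation_gt_le {N : ℕ} (hN : 0 < N) :
    p.stationaryLaw {ω | ∃ s t, (N : ℝ) ^ 3 < |fluctuation p.P s t (N ^ 4) ω|} ≤
      ENNReal.ofReal (Fintype.card S ^ 2 / (N : ℝ) ^ 2) := by
  have hset : {ω | ∃ s t, (N : ℝ) ^ 3 < |fluctuation p.P s t (N ^ 4) ω|} =
      ⋃ z : S × S, {ω | (N : ℝ) ^ 3 < |fluctuation p.P z.1 z.2 (N ^ 4) ω|} := by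
    ext ω; simp
  rw [hset]
  refine (measure_iUnion_fintype_le _ _).trans
    ((Finset.sum_le_sum fun z _ => p.measure_fluctuation_gt_le z.1 z.2 hN).trans ?_)
  rw [← ENNReal.ofReal_sum_of_nonneg fun _ _ => by positivity]
  refine ENNReal.ofReal_le_ofReal (le_of_eq ?_)
  simp only [Finset.sum_const, Finset.card_univ, Fintype.card_prod, nsmul_eq_mul, Nat.cast_mul]
  ring

end Probability

end IrreducibleChain

/-! ### Chains consistent with the same counts have close stationary distributions -/

/-- The fraction of time among `X_1, …, X_n` spent in each state. -/
noncomputable def occupation {S : Type*} [DecidableEq S] (ω : ℕ → S) (n : ℕ) (s : S) : ℝ :=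
  (∑ i ∈ Finset.range n, if ω (i + 1) = s then 1 else 0) / n

lemma occupation_mem_stdSimplex {S : Type*} [Fintype S] [DecidableEq S] (ω : ℕ → S) {n : ℕ}
    (hn : 0 < n) : occupation ω n ∈ stdSimplex ℝ S := by
  refine ⟨fun s => by unfold occupation; positivity, ?_⟩
  have : (n : ℝ) ≠ 0 := by positivity
  simp only [occupation, ← Finset.sum_div]
  rw [Finset.sum_comm]
  simp [this]

lemma fluctuation_eq {S : Type*} [DecidableEq S] (Q : Matrix S S ℝ) (s t : S) (n : ℕ) (ω : ℕ → S) :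
    fluctuation Q s t n ω =
      (∑ i ∈ Finset.range n, if ω (i + 1) = s then (if ω (i + 2) = t then 1 else 0) else 0) -
        n * occupation ω n s * Q s t := by
  rcases n.eq_zero_or_pos with rfl | hn
  · simp [fluctuation]
  · have : (n : ℝ) ≠ 0 := by positivity
    rw [occupation, mul_div_cancel₀ _ this, Finset.sum_mul, ← Finset.sum_sub_distrib]
    refine Finset.sum_congr rfl fun i _ => ?_
    split_ifs <;> simp

/-- Arrivals at `t` and visits to `t` differ only by boundary terms, so small fluctuations make the
occupation vector almost stationary. -/
lemma sum_fluctuation {S : Type*} [Fintype S] [DecidableEq S] (Q : Matrix S S ℝ) (t : S) (n : ℕ)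
    (ω : ℕ → S) :
    ∑ s, fluctuation Q s t n ω = n * (occupation ω n t - (occupation ω n ᵥ* Q) t) +
      (if ω (n + 1) = t then 1 else 0) - (if ω 1 = t then 1 else 0) := by
  have h1 : ∑ s, ∑ i ∈ Finset.range n,
      (if ω (i + 1) = s then (if ω (i + 2) = t then (1 : ℝ) else 0) else 0) =
      ∑ i ∈ Finset.range n, if ω (i + 2) = t then 1 else 0 := by
    rw [Finset.sum_comm]
    simp
  have h2 : (n : ℝ) * occupation ω n t = ∑ i ∈ Finset.range n, if ω (i + 1) = t then 1 else 0 := by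
    rcases n.eq_zero_or_pos with rfl | hn
    · simp
    · rw [occupation, mul_div_cancel₀ _ (by positivity)]
  have h3 := Finset.sum_range_sub (fun i => if ω (i + 1) = t then (1 : ℝ) else 0) n
  rw [Finset.sum_sub_distrib] at h3
  simp only [fluctuation_eq, Finset.sum_sub_distrib]
  rw [h1, mul_sub, h2]
  simp only [Matrix.vecMul, dotProduct, Finset.mul_sum, ← mul_assoc]
  simp only [add_assoc, zero_add, one_add_one_eq_two] at h3 ⊢
  linarith

namespace IrreducibleChain

section Deterministic

variable {S : Type*} [Fintype S] [Nonempty S] [DecidableEq S] (p : IrreducibleChain S)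

lemma stationary_vecMul : (p.stationary : S → ℝ) ᵥ* p.P = p.stationary :=
  p.existsUnique_stationary.choose_spec.1

lemma eq_stationary {v : stdSimplex ℝ S} (hv : (v : S → ℝ) ᵥ* p.P = v) : v = p.stationary :=
  p.existsUnique_stationary.choose_spec.2 v hv

lemma stationary_pos (s : S) : 0 < (p.stationary : S → ℝ) s := by
  obtain ⟨i, -, hi⟩ : ∃ i ∈ Finset.univ, 0 < (p.stationary : S → ℝ) i := by
    refine Finset.exists_lt_of_sum_lt (f := fun _ => (0 : ℝ)) ?_
    have hsum : ∑ s, (p.stationary : S → ℝ) s = 1 := p.stationary.2.2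
    rw [hsum]
    simp
  exact p.pos_of_fixed p.stationary.2.1 p.stationary_vecMul hi s

/-- Almost stationary distributions are close to the stationary one. -/
lemma exists_norm_sub_stationary_le {ε : ℝ} (hε : 0 < ε) :
    ∃ δ > 0, ∀ v : stdSimplex ℝ S, ‖(v : S → ℝ) ᵥ* p.P - v‖ ≤ δ →
      ‖(v : S → ℝ) - p.stationary‖ ≤ ε := by
  have hcont : Continuous fun v : S → ℝ => ‖v ᵥ* p.P - v‖ :=
    ((Continuous.matrix_vecMul continuous_id continuous_const).sub continuous_id).norm
  -- On this compact set the defect `‖v ᵥ* p.P - v‖` attains a minimum, which is positive by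
  -- uniqueness of the stationary vector.
  let K : Set (S → ℝ) := stdSimplex ℝ S ∩ {v | ε ≤ ‖v - (p.stationary : S → ℝ)‖}
  have hK : IsCompact K := (isCompact_stdSimplex ℝ S).inter_right
    (isClosed_le continuous_const (continuous_id.sub continuous_const).norm)
  rcases K.eq_empty_or_nonempty with h | h
  · refine ⟨1, one_pos, fun v _ => ?_⟩
    by_contra! hv
    exact (Set.eq_empty_iff_forall_notMem.1 h v) ⟨v.2, hv.le⟩
  · obtain ⟨w, hw, hmin⟩ := hK.exists_isMinOn h hcont.continuousOn
    have hpos : 0 < ‖w ᵥ* p.P - w‖ := by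
      rw [norm_pos_iff, sub_ne_zero]
      intro he
      have := p.eq_stationary (v := ⟨w, hw.1⟩) he
      have h2 : ε ≤ ‖w - (p.stationary : S → ℝ)‖ := hw.2
      rw [← this] at h2
      change ε ≤ ‖w - w‖ at h2
      rw [sub_self, norm_zero] at h2
      linarith
    refine ⟨‖w ᵥ* p.P - w‖ / 2, by positivity, fun v hv => ?_⟩
    by_contra! hv'
    have := isMinOn_iff.1 hmin v ⟨v.2, hv'.le⟩
    linarith

/-- If the transition counts up to time `N ^ 4` are consistent with the chains `p` and `q`, for
large `N`, then the stationary distributions of `p` and `q` are close. -/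
lemma exists_norm_stationary_sub_le {ε : ℝ} (hε : 0 < ε) :
    ∃ N₀ : ℕ, ∀ N ≥ N₀, ∀ (ω : ℕ → S) (q : IrreducibleChain S),
      (∀ s t, |fluctuation p.P s t (N ^ 4) ω| ≤ (N : ℝ) ^ 3) →
      (∀ s t, |fluctuation q.P s t (N ^ 4) ω| ≤ (N : ℝ) ^ 3) →
      ‖(p.stationary : S → ℝ) - q.stationary‖ ≤ ε := by
  obtain ⟨s₀, hs₀⟩ := Finite.exists_min (p.stationary : S → ℝ)
  set m := (p.stationary : S → ℝ) s₀
  have hm : 0 < m := p.stationary_pos s₀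
  obtain ⟨δ₁, hδ₁, h₁⟩ := p.exists_norm_sub_stationary_le (half_pos hm)
  obtain ⟨δ₂, hδ₂, h₂⟩ := p.exists_norm_sub_stationary_le hε
  -- The second bound gives `(card S * N ^ 3 + 1) / N ^ 4 ≤ δ₁`, the 1 being the boundary term; the
  -- third gives `2 * N ^ 3 / (N ^ 4 * (m / 2)) ≤ δ₂`.
  obtain ⟨N₀, hN₀⟩ := exists_nat_ge (max 1 (max ((Fintype.card S + 1) / δ₁) (4 / (m * δ₂))))
  refine ⟨N₀, fun N hN ω q hp hq => ?_⟩
  have hNr := hN₀.trans (Nat.cast_le.2 hN)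
  simp only [max_le_iff, div_le_iff₀ hδ₁, div_le_iff₀ (mul_pos hm hδ₂)] at hNr
  obtain ⟨hN1, hNa, hNb⟩ := hNr
  have hNpos : 0 < N := Nat.cast_pos.1 (by linarith : (0 : ℝ) < N)
  have h3pos : (1 : ℝ) ≤ (N : ℝ) ^ 3 := one_le_pow₀ hN1
  set μ := occupation ω (N ^ 4) with hμ
  have hμs : μ ∈ stdSimplex ℝ S := occupation_mem_stdSimplex ω (by positivity)
  have hμclose : ‖μ - (p.stationary : S → ℝ)‖ ≤ m / 2 := by
    refine h₁ ⟨μ, hμs⟩ ((pi_norm_le_iff_of_nonneg hδ₁.le).2 fun t => ?_)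
    have hs := sum_fluctuation p.P t (N ^ 4) ω
    have hb : |∑ s, fluctuation p.P s t (N ^ 4) ω| ≤ Fintype.card S * (N : ℝ) ^ 3 :=
      (Finset.abs_sum_le_sum_abs _ _).trans
        ((Finset.sum_le_card_nsmul _ _ _ fun s _ => hp s t).trans (by simp))
    have hi : |(if ω (N ^ 4 + 1) = t then (1 : ℝ) else 0) - (if ω 1 = t then 1 else 0)| ≤ 1 := by
      split_ifs <;> simp
    rw [← hμ] at hs
    push_cast at hs
    rw [abs_le] at hb hi
    change |(μ ᵥ* p.P) t - μ t| ≤ δ₁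
    rw [abs_sub_comm]
    have hbd : |(N : ℝ) ^ 4 * (μ t - (μ ᵥ* p.P) t)| ≤ (N : ℝ) ^ 4 * δ₁ := by
      have h4 : (Fintype.card S + 1) * (N : ℝ) ^ 3 ≤ (N : ℝ) ^ 4 * δ₁ := by
        calc _ ≤ (N * δ₁) * (N : ℝ) ^ 3 := by gcongr
          _ = _ := by ring
      rw [abs_le]
      constructor <;> linarith
    rw [abs_mul, abs_of_pos (by positivity)] at hbd
    exact le_of_mul_le_mul_left hbd (by positivity)
  have hμpos : ∀ s, m / 2 ≤ μ s := fun s => by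
    have := (norm_le_pi_norm (μ - (p.stationary : S → ℝ)) s).trans hμclose
    rw [Real.norm_eq_abs, Pi.sub_apply, abs_le] at this
    linarith [hs₀ s]
  have hPQ : ∀ s t, |p.P s t - q.P s t| ≤ δ₂ := fun s t => by
    -- The observed counts cancel, leaving only the difference of the predicted values.
    have hd : fluctuation q.P s t (N ^ 4) ω - fluctuation p.P s t (N ^ 4) ω =
        (N : ℝ) ^ 4 * μ s * (p.P s t - q.P s t) := by
      rw [fluctuation_eq, fluctuation_eq]
      push_cast
      ring
    have hle : |(N : ℝ) ^ 4 * μ s * (p.P s t - q.P s t)| ≤ 2 * (N : ℝ) ^ 3 := by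
      rw [← hd]
      linarith [abs_sub (fluctuation q.P s t (N ^ 4) ω) (fluctuation p.P s t (N ^ 4) ω),
        hp s t, hq s t]
    have hc : (N : ℝ) ^ 4 * (m / 2) ≤ (N : ℝ) ^ 4 * μ s := by gcongr; exact hμpos s
    have hc0 : 0 < (N : ℝ) ^ 4 * (m / 2) := by positivity
    rw [abs_mul, abs_of_pos (hc0.trans_le hc)] at hle
    refine le_of_mul_le_mul_left ((mul_le_mul_of_nonneg_right hc (abs_nonneg _)).trans
      (hle.trans ?_)) hc0
    calc 2 * (N : ℝ) ^ 3 = 4 * ((N : ℝ) ^ 3 / 2) := by ring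
      _ ≤ (N * (m * δ₂)) * ((N : ℝ) ^ 3 / 2) := by gcongr
      _ = _ := by ring
  rw [norm_sub_rev]
  refine h₂ q.stationary ((pi_norm_le_iff_of_nonneg hδ₂.le).2 fun t => ?_)
  have hq0 : (q.stationary : S → ℝ) ᵥ* p.P - q.stationary =
      (q.stationary : S → ℝ) ᵥ* (p.P - q.P) := by
    rw [Matrix.vecMul_sub, q.stationary_vecMul]
  rw [hq0]
  calc |∑ s, (q.stationary : S → ℝ) s * (p.P - q.P) s t|
      ≤ ∑ s, |(q.stationary : S → ℝ) s * (p.P - q.P) s t| := Finset.abs_sum_le_sum_abs _ _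
    _ ≤ ∑ s, (q.stationary : S → ℝ) s * δ₂ := by
        refine Finset.sum_le_sum fun s _ => ?_
        have h0 : 0 ≤ (q.stationary : S → ℝ) s := q.stationary.2.1 s
        rw [abs_mul, abs_of_nonneg h0]
        exact mul_le_mul_of_nonneg_left (hPQ s t) h0
    _ = δ₂ := by
        rw [← Finset.sum_mul]
        exact (congrArg (· * δ₂) q.stationary.2.2).trans (one_mul _)

end Deterministic

end IrreducibleChain

/-! ### Prediction and stopping rules -/

lemma exists_le_of_stopTime_le {X : Type*} {τ : (n : ℕ) → (Fin n → X) → Fin 2} {ω : ℕ → X} {k : ℕ}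
    (h : stopTime τ ω ≤ k) : ∃ n ≤ k, 1 ≤ n ∧ τ n (observed ω n) = 1 := by
  by_contra! hn
  have : ((k + 1 : ℕ) : ℕ∞) ≤ stopTime τ ω := by
    refine le_iInf₂ fun n h1 => Nat.cast_le.2 ?_
    by_contra! hlt
    exact hn n (by omega) h1.1 h1.2
  have := Nat.cast_le.1 (this.trans h)
  omega

/-- A path that extends a given string. -/
noncomputable def extendString {X : Type*} [Nonempty X] {m : ℕ} (x : Fin m → X) (i : ℕ) : X :=
  -- Position 0 stands for the hidden `X_0`; its value is junk, and fluctuations never read it.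
  if h : i - 1 < m then x ⟨i - 1, h⟩ else Classical.arbitrary X

lemma extendString_observed {X : Type*} [Nonempty X] (ω : ℕ → X) {m i : ℕ} (h1 : 1 ≤ i)
    (h2 : i ≤ m) : extendString (observed ω m) i = ω i := by
  rw [extendString, dif_pos (by omega), observed]
  exact congrArg ω (by simp; omega)

namespace IrreducibleChain

section Learning

variable {S : Type*} [Fintype S] [DecidableEq S]

/-- The chains that are consistent with the first `m` observations, when the transition counts
are tested at the times `N j ^ 4`. -/
def consistentSet (N : ℕ → ℕ) (m : ℕ) (ω : ℕ → S) : Set (IrreducibleChain S) :=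
  {q | ∀ j, N j ^ 4 + 1 ≤ m → ∀ s t, |fluctuation q.P s t (N j ^ 4) ω| ≤ (N j : ℝ) ^ 3}

lemma consistentSet_anti (N : ℕ → ℕ) {m m' : ℕ} (h : m ≤ m') (ω : ℕ → S) :
    consistentSet N m' ω ⊆ consistentSet N m ω := fun _ hq j hj => hq j (hj.trans h)

lemma consistentSet_congr (N : ℕ → ℕ) {m : ℕ} {ω ω' : ℕ → S}
    (h : ∀ i, 1 ≤ i → i ≤ m → ω i = ω' i) : consistentSet N m ω = consistentSet N m ω' := by
  ext q
  refine forall_congr' fun j => forall_congr' fun hj => forall₂_congr fun s t => ?_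
  rw [fluctuation_congr q.P s t fun i h1 h2 => h i h1 (h2.trans hj)]

variable [Nonempty S]

/-- The predictions that have no loss for any chain consistent with the observations. -/
def safePredictions (ε : ℝ) (N : ℕ → ℕ) (m : ℕ) (ω : ℕ → S) : Set (stdSimplex ℝ S) :=
  {y | ∀ q ∈ consistentSet N m ω, ‖(y : S → ℝ) - q.stationary‖ ≤ ε}

open Classical in
/-- Predict a vector that is safe given the observations, if there is one. -/
noncomputable def safeRule (ε : ℝ) (N : ℕ → ℕ) (m : ℕ) (x : Fin m → S) : stdSimplex ℝ S :=
  if h : (safePredictions ε N m (extendString x)).Nonempty then h.some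
  else Classical.arbitrary _

open Classical in
/-- Stop as soon as there was a safe prediction one step ago. -/
noncomputable def safeStop (ε : ℝ) (N : ℕ → ℕ) (m : ℕ) (x : Fin m → S) : Fin 2 :=
  if (safePredictions ε N (m - 1) (extendString x)).Nonempty then 1 else 0

lemma safePredictions_extendString (ε : ℝ) (N : ℕ → ℕ) {m m' : ℕ} (h : m ≤ m') (ω : ℕ → S) :
    safePredictions ε N m (extendString (observed ω m')) = safePredictions ε N m ω := by
  unfold safePredictions
  rw [consistentSet_congr N fun i h1 h2 => extendString_observed ω h1 (h2.trans h)]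

lemma safeRule_mem {ε : ℝ} {N : ℕ → ℕ} {m : ℕ} {ω : ℕ → S}
    (h : (safePredictions ε N m ω).Nonempty) :
    safeRule ε N m (observed ω m) ∈ safePredictions ε N m ω := by
  rw [← safePredictions_extendString ε N le_rfl ω] at h ⊢
  rw [safeRule, dif_pos h]
  exact h.some_mem

lemma safeStop_eq_one_iff {ε : ℝ} {N : ℕ → ℕ} {m : ℕ} {ω : ℕ → S} :
    safeStop ε N m (observed ω m) = 1 ↔ (safePredictions ε N (m - 1) ω).Nonempty := by
  rw [safeStop, safePredictions_extendString ε N (Nat.sub_le m 1) ω]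
  split_ifs with h <;> simp [h]

/-- Consistent sets shrink with time, so a prediction that is safe once stays safe. The one-step
delay in `safeStop` matches the use of `k - 1` observations at time `k`. -/
lemma stationaryLoss_safeRule_eq_zero {ε : ℝ} {N : ℕ → ℕ} {ω : ℕ → S} (p : IrreducibleChain S)
    (hp : ∀ m, p ∈ consistentSet N m ω) {k : ℕ} (hk : stopTime (safeStop ε N) ω ≤ k) :
    stationaryLoss ε p k (observed ω k) (safeRule ε N (k - 1) (observed ω (k - 1))) = 0 := by
  obtain ⟨n, hnk, -, hn⟩ := exists_le_of_stopTime_le hk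
  obtain ⟨y, hy⟩ := safeStop_eq_one_iff.1 hn
  have hy' : y ∈ safePredictions ε N (k - 1) ω := fun q hq =>
    hy q (consistentSet_anti N (Nat.sub_le_sub_right hnk 1) ω hq)
  exact if_neg (not_lt.2 (safeRule_mem ⟨y, hy'⟩ p (hp _)))

end Learning

end IrreducibleChain

/-! ### Choice of test times and conclusion -/

theorem theorem9 {S : Type*} [Fintype S] [Nonempty S] [DecidableEq S] [MeasurableSpace S]
    [DiscreteMeasurableSpace S] (ε : ℝ) (hε : 0 < ε) :
    EASLearnable (fun p : IrreducibleChain S => p.stationaryLaw)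
      (fun p : IrreducibleChain S => IrreducibleChain.stationaryLoss ε p) := by
  intro η hη
  obtain ⟨δ, hδ, hδsum⟩ := ENNReal.exists_pos_sum_of_countable'
    (ENNReal.ofReal_pos.2 hη).ne' ℕ
  -- The bound `j + 1 ≤ n` keeps the test scales positive and sends them to infinity.
  have hex : ∀ j : ℕ, ∃ n : ℕ, j + 1 ≤ n ∧
      ENNReal.ofReal (Fintype.card S ^ 2 / (n : ℝ) ^ 2) ≤ δ j := fun j => by
    have hlim : Filter.Tendsto (fun n : ℕ => ENNReal.ofReal (Fintype.card S ^ 2 / (n : ℝ) ^ 2))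
        Filter.atTop (nhds 0) := by
      rw [← ENNReal.ofReal_zero]
      exact ENNReal.tendsto_ofReal (tendsto_const_nhds.div_atTop
        ((Filter.tendsto_pow_atTop two_ne_zero).comp tendsto_natCast_atTop_atTop))
    obtain ⟨n, h1, h2⟩ := ((Filter.eventually_ge_atTop (j + 1)).and
      (hlim.eventually (gt_mem_nhds (hδ j)))).exists
    exact ⟨n, h1, h2.le⟩
  choose N hN hNδ using hex
  refine ⟨IrreducibleChain.safeRule ε N, IrreducibleChain.safeStop ε N, fun n => .of_discrete,
    fun n => .of_discrete, fun p => ?_⟩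
  set bad : ℕ → Set (ℕ → S) := fun j =>
    {ω | ∃ s t, (N j : ℝ) ^ 3 < |fluctuation p.P s t (N j ^ 4) ω|}
  have hbad : ∀ j, p.stationaryLaw (bad j) ≤ δ j := fun j =>
    (p.measure_exists_fluctuation_gt_le (by have := hN j; omega)).trans (hNδ j)
  refine ⟨lt_of_le_of_lt ?_ hδsum, ?_⟩
  · refine (measure_mono (t := ⋃ j, bad j) fun ω hω => ?_).trans
      ((measure_iUnion_le _).trans (ENNReal.tsum_le_tsum hbad))
    by_contra hnot
    simp only [bad, Set.mem_iUnion, Set.mem_ofPred_eq, not_exists, not_lt] at hnot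
    refine (Set.mem_ofPred.1 hω).ne' (ENNReal.tsum_eq_zero.2 fun k => ?_)
    beta_reduce
    rw [p.stationaryLoss_safeRule_eq_zero (fun m j _ => hnot j) k.2]
    simp
  · obtain ⟨N₀, hN₀⟩ := p.exists_norm_stationary_sub_le hε
    refine le_antisymm prob_le_one ?_
    -- Passing a single late test forces a stop, so the stopping probability is at least `1 - δ j`
    -- for all large `j`.
    have hle : ∀ j ≥ N₀, 1 - δ j ≤
        p.stationaryLaw
          {ω | ∃ n : ℕ, 1 ≤ n ∧ IrreducibleChain.safeStop ε N n (observed ω n) = 1} := by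
      intro j hj
      have hsub : (bad j)ᶜ ⊆
          {ω | ∃ n : ℕ, 1 ≤ n ∧ IrreducibleChain.safeStop ε N n (observed ω n) = 1} := by
        intro ω hω
        simp only [bad, Set.mem_compl_iff, Set.mem_ofPred_eq, not_exists, not_lt] at hω
        -- `N j ^ 4` transitions need one further observation; the last `+ 1` offsets the delay in
        -- `safeStop`. The safe prediction is the true stationary vector itself.
        refine ⟨N j ^ 4 + 1 + 1, by omega,
          IrreducibleChain.safeStop_eq_one_iff.2 ⟨p.stationary, fun q hq => ?_⟩⟩
        exact hN₀ (N j) (by have := hN j; omega) ω q hω (hq j le_rfl)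
      refine le_trans ?_ (measure_mono hsub)
      refine (tsub_le_tsub_left (hbad j) 1).trans ?_
      rw [tsub_le_iff_left, ← measure_univ (μ := p.stationaryLaw), ← Set.union_compl_self (bad j)]
      exact measure_union_le _ _
    have hδ0 : Filter.Tendsto δ Filter.atTop (nhds 0) :=
      ENNReal.tendsto_atTop_zero_of_tsum_ne_top hδsum.ne_top
    have hlim : Filter.Tendsto (fun j => 1 - δ j) Filter.atTop (nhds 1) := by
      simpa using ENNReal.Tendsto.sub tendsto_const_nhds hδ0 (.inl ENNReal.one_ne_top)
    exact le_of_tendsto hlim ((Filter.eventually_ge_atTop N₀).mono hle)
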